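/- Let $S^2\subset\mathbb{R}^3$ be the unit sphere. A \emph{circular line} is an intersection of $S^2$ with an affine plane that contains more than one point. A \emph{spherical cap} is a closed connected set $C\subset S^2$ with nonempty interior whose boundary in $S^2$ is a circular line; its \emph{center} $p(C)$ is the unique point of $C$ that has the same Euclidean distance to all points of the boundary of $C$. Let $V$ be a finite set and let $(C_v)_{v\in V}$ be a univalent circle packing in $S^2$, i.e. a family of spherical caps whose interiors are mutually disjoint. Let $m:V\to(0,\infty)$ and $m(V)=\sum_{v\in V}m(v)$. Suppose that $2m(u)<m(V)$ for all $u\in V$, and that $$2\bigl(m(u)+m(v)\bigr)<m(V)\quad\text{for all } u\neq v \text{ in } V \text{ with } C_u\cap C_v\neq\emptyset.$$ Then there is a homeomorphism $f:S^2\to S^2$ that maps spherical caps to spherical caps, such that $(f(C_v))_{v\in V}$ is again a univalent circle packing and $$\sum_{v\in V}m(v)\,p(f(C_v))=0 .$$ -/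

import Mathlib

namespace CapPacking

/-- The unit sphere `S²` in Euclidean `ℝ³`, with the subspace topology and Euclidean distance. -/
abbrev S2 : Type := Metric.sphere (0 : EuclideanSpace ℝ (Fin 3)) 1

/-- A circular line: the intersection of `S²` with a plane `{y | ⟪n, y⟫ = c}`, `n ≠ 0`, that
contains more than one point. -/
def IsCircularLine (k : Set S2) : Prop :=
  k.Nontrivial ∧ ∃ (n : EuclideanSpace ℝ (Fin 3)) (c : ℝ), n ≠ 0 ∧
    k = {x : S2 | inner ℝ n (x : EuclideanSpace ℝ (Fin 3)) = c}

/-- A spherical cap: a closed connected subset of `S²` whose boundary in `S²` is a circular line.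
Nonempty interior rules out a circular line itself, which is closed, connected and its own
boundary. -/
structure IsSphericalCap (C : Set S2) : Prop where
  isClosed : IsClosed C
  isConnected : IsConnected C
  interior_nonempty : (interior C).Nonempty
  frontier_isCircularLine : IsCircularLine (frontier C)

/-- `p` is the center of the cap `C`: it is the one and only point of `C` that has equal Euclidean
distance to all points of the boundary of `C`. -/
def IsCapCenter (C : Set S2) (p : S2) : Prop :=
  ∀ q : S2, (q ∈ C ∧ ∃ r : ℝ, ∀ x ∈ frontier C, dist q x = r) ↔ q = p

/-- A univalent circle packing in `S²`: a family of spherical caps with mutually disjoint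
interiors. -/
structure IsUnivalentCirclePacking {V : Type*} (C : V → Set S2) : Prop where
  isSphericalCap : ∀ v, IsSphericalCap (C v)
  disjoint_interior : ∀ u v, u ≠ v → Disjoint (interior (C u)) (interior (C v))

end CapPacking

/-! View `S²` as the ideal boundary of hyperbolic 3-space, in the hyperboloid model with points `(x,
height x)`. Each cap bounds a hyperbolic plane; let `F` be the sum, weighted by `m`, of the signed
distances to these planes, positive on the side of the cap. At a critical point of `F` the weighted
unit normals to the level surfaces of these distances cancel. The Lorentz boost moving that point to
the base point turns these normals into the centers of the boosted caps, so this boost is the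
required `f`.

A critical point exists because `F` tends to `-∞` at infinity and so attains a maximum. Towards an
ideal point `ξ`, a signed distance is at most `log (height x)` plus a constant if its cap contains
`ξ`, and at most `-log (height x)` plus a constant otherwise. The total coefficient is twice the
mass of the caps through `ξ` minus the whole mass. Disjointness of interiors allows at most two caps
through `ξ`, so the mass hypotheses make it negative (`sum_ite_neg`, `tendsto_sum_planeDist_atBot`,
`exists_sum_boostNormal_eq_zero`). -/

namespace CapPacking

open scoped RealInnerProductSpace
open Filter Topology

/-! ### Lorentz boosts acting on the unit sphere -/

section Height

variable {E : Type*} [NormedAddCommGroup E]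

/-- The time coordinate of the point of the hyperboloid lying over `x`. -/
noncomputable def height (x : E) : ℝ := √(1 + ‖x‖ ^ 2)

lemma height_sq (x : E) : height x ^ 2 = 1 + ‖x‖ ^ 2 := Real.sq_sqrt (by positivity)

lemma one_le_height (x : E) : 1 ≤ height x :=
  Real.one_le_sqrt.2 (by nlinarith [sq_nonneg ‖x‖])

lemma height_pos (x : E) : 0 < height x := one_pos.trans_le (one_le_height x)

lemma norm_lt_height (x : E) : ‖x‖ < height x :=
  Real.lt_sqrt_of_sq_lt (by linarith)

lemma height_neg (x : E) : height (-x) = height x := by simp [height]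

lemma continuous_height : Continuous (height : E → ℝ) := by
  unfold height; fun_prop

lemma tendsto_height_atTop [ProperSpace E] : Tendsto (height : E → ℝ) (cocompact E) atTop :=
  tendsto_atTop_mono (fun x => (norm_lt_height x).le) tendsto_norm_cocompact_atTop

end Height

section Boost

variable {E : Type*} [NormedAddCommGroup E] [InnerProductSpace ℝ E]

lemma inner_lt_height (x : E) {y : E} (hy : ‖y‖ = 1) : ⟪x, y⟫ < height x := by
  have := real_inner_le_norm x y
  rw [hy, mul_one] at this
  exact this.trans_lt (norm_lt_height x)

/-- The action on the light cone directions of the Lorentz boost that moves the point of the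
hyperboloid over `x` to the base point. -/
noncomputable def boost (x y : E) : E :=
  (height x - ⟪x, y⟫)⁻¹ • (y + (⟪x, y⟫ / (1 + height x) - 1) • x)

lemma inner_boost (x n : E) (y : E) :
    ⟪n, boost x y⟫ =
      (height x - ⟪x, y⟫)⁻¹ * (⟪n, y⟫ + (⟪x, y⟫ / (1 + height x) - 1) * ⟪n, x⟫) := by
  rw [boost, inner_smul_right, inner_add_right, inner_smul_right]

/-- The boost sends the light-like vector `(y, 1)` to one with time part `height x - ⟪x, y⟫`. By
`key` the image is again light-like, and `boost` rescales it to time part 1. -/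
lemma norm_boost (x : E) {y : E} (hy : ‖y‖ = 1) : ‖boost x y‖ = 1 := by
  have hD : 0 < height x - ⟪x, y⟫ := sub_pos.2 (inner_lt_height x hy)
  have h1 : (1 + height x) ≠ 0 := by linarith [height_pos x]
  have hX : ‖x‖ ^ 2 = height x ^ 2 - 1 := by rw [height_sq]; ring
  have key : ‖y + (⟪x, y⟫ / (1 + height x) - 1) • x‖ ^ 2 = (height x - ⟪x, y⟫) ^ 2 := by
    rw [norm_add_sq_real, norm_smul, mul_pow, hX, hy, inner_smul_right, real_inner_comm,
      Real.norm_eq_abs, sq_abs]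
    field_simp
    ring
  rw [boost, norm_smul, Real.norm_eq_abs, abs_of_pos (inv_pos.2 hD),
    (pow_left_inj₀ (norm_nonneg _) hD.le two_ne_zero).1 key, inv_mul_cancel₀ hD.ne']

lemma height_add_inner_boost (x : E) {y : E} (hy : ‖y‖ = 1) :
    height x + ⟪x, boost x y⟫ = (height x - ⟪x, y⟫)⁻¹ := by
  have hD : height x - ⟪x, y⟫ ≠ 0 := (sub_pos.2 (inner_lt_height x hy)).ne'
  have h1 : (1 + height x) ≠ 0 := by linarith [height_pos x]
  have hX : ‖x‖ ^ 2 = height x ^ 2 - 1 := by rw [height_sq]; ring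
  rw [inner_boost, real_inner_self_eq_norm_sq, hX]
  field_simp
  ring

lemma boost_neg_boost (x : E) {y : E} (hy : ‖y‖ = 1) : boost (-x) (boost x y) = y := by
  have hD : height x - ⟪x, y⟫ ≠ 0 := (sub_pos.2 (inner_lt_height x hy)).ne'
  have h1 : (1 + height x) ≠ 0 := by linarith [height_pos x]
  have hi : ⟪x, boost x y⟫ = (height x - ⟪x, y⟫)⁻¹ - height x := by
    rw [← height_add_inner_boost x hy]; ring
  rw [boost, height_neg, inner_neg_left, sub_neg_eq_add, height_add_inner_boost x hy, inv_inv, hi,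
    boost, smul_add, smul_smul, mul_inv_cancel₀ hD, one_smul, add_assoc, smul_neg, ← neg_smul,
    smul_smul, ← add_smul]
  convert add_zero y
  rw [smul_eq_zero]
  left
  field_simp
  ring

lemma continuous_boost (x : E) :
    Continuous fun y : Metric.sphere (0 : E) 1 => boost x (y : E) := by
  unfold boost
  refine Continuous.smul (Continuous.inv₀ (by fun_prop) fun y => ?_) (by fun_prop)
  exact (sub_pos.2 (inner_lt_height x (norm_eq_of_mem_sphere y))).ne'

/-- The boost as a homeomorphism of the unit sphere. -/
noncomputable def boostHomeo (x : E) :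
    Metric.sphere (0 : E) 1 ≃ₜ Metric.sphere (0 : E) 1 where
  toFun y := ⟨boost x y, mem_sphere_zero_iff_norm.2 (norm_boost x (norm_eq_of_mem_sphere y))⟩
  invFun y := ⟨boost (-x) y, mem_sphere_zero_iff_norm.2 (norm_boost _ (norm_eq_of_mem_sphere y))⟩
  left_inv y := Subtype.ext (boost_neg_boost x (norm_eq_of_mem_sphere y))
  right_inv y := Subtype.ext (by
    simpa using boost_neg_boost (-x) (norm_eq_of_mem_sphere y))
  continuous_toFun := (continuous_boost x).subtype_mk _
  continuous_invFun := (continuous_boost (-x)).subtype_mk _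

/-- The spatial part of the image under the boost along `x` of the vector `(n, c)`. -/
noncomputable def boostNormal (x n : E) (c : ℝ) : E :=
  n + (⟪n, x⟫ / (1 + height x)) • x - c • x

/-- The time part of the image under the boost along `x` of the vector `(n, c)`. -/
noncomputable def boostLevel (x n : E) (c : ℝ) : ℝ := c * height x - ⟪n, x⟫

/-- Lorentz invariance of the quadratic form `‖n‖ ^ 2 - c ^ 2`. -/
lemma norm_boostNormal_sq (x n : E) (c : ℝ) :
    ‖boostNormal x n c‖ ^ 2 = ‖n‖ ^ 2 - c ^ 2 + boostLevel x n c ^ 2 := by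
  have h1 : (1 + height x) ≠ 0 := by linarith [height_pos x]
  have hX : ‖x‖ ^ 2 = height x ^ 2 - 1 := by rw [height_sq]; ring
  rw [boostNormal, add_sub_assoc, ← sub_smul, norm_add_sq_real, norm_smul, mul_pow, hX,
    inner_smul_right, Real.norm_eq_abs, sq_abs, boostLevel]
  field_simp
  ring

/-- The boost carries the half-space function of `(n, c)` to that of the boosted vector, up to a
positive factor. -/
lemma inner_boost_neg_sub (x n : E) (c : ℝ) {y : E} (hy : ‖y‖ = 1) :
    ⟪n, boost (-x) y⟫ - c =
      (height x + ⟪x, y⟫)⁻¹ * (⟪boostNormal x n c, y⟫ - boostLevel x n c) := by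
  have hD : height x + ⟪x, y⟫ ≠ 0 := by
    have := inner_lt_height (-x) hy
    rw [height_neg, inner_neg_left] at this
    linarith
  have h1 : (1 + height x) ≠ 0 := by linarith [height_pos x]
  rw [inner_boost, boostNormal, boostLevel, height_neg]
  simp only [inner_neg_left, inner_neg_right, inner_add_left, inner_sub_left, inner_smul_left,
    sub_neg_eq_add, conj_trivial]
  field_simp
  ring

lemma height_add_inner_pos (x : E) {y : E} (hy : ‖y‖ = 1) : 0 < height x + ⟪x, y⟫ := by
  have := inner_lt_height (-x) hy
  rw [height_neg, inner_neg_left] at this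
  linarith

lemma boostHomeo_image_setOf_eq (x n : E) (c : ℝ) :
    boostHomeo x '' {y : Metric.sphere (0 : E) 1 | ⟪n, (y : E)⟫ = c} =
      {y : Metric.sphere (0 : E) 1 | ⟪boostNormal x n c, (y : E)⟫ = boostLevel x n c} := by
  rw [← Homeomorph.preimage_symm]
  ext y
  change ⟪n, boost (-x) y⟫ = c ↔ _
  rw [← sub_eq_zero, inner_boost_neg_sub x n c (norm_eq_of_mem_sphere y), mul_eq_zero,
    or_iff_right (inv_pos.2 (height_add_inner_pos x (norm_eq_of_mem_sphere y))).ne', sub_eq_zero]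
  rfl

lemma boostHomeo_image_setOf_le (x n : E) (c : ℝ) :
    boostHomeo x '' {y : Metric.sphere (0 : E) 1 | c ≤ ⟪n, (y : E)⟫} =
      {y : Metric.sphere (0 : E) 1 | boostLevel x n c ≤ ⟪boostNormal x n c, (y : E)⟫} := by
  rw [← Homeomorph.preimage_symm]
  ext y
  change c ≤ ⟪n, boost (-x) y⟫ ↔ _
  rw [← sub_nonneg, inner_boost_neg_sub x n c (norm_eq_of_mem_sphere y),
    mul_nonneg_iff_of_pos_left (inv_pos.2 (height_add_inner_pos x (norm_eq_of_mem_sphere y))),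
    sub_nonneg]
  rfl

end Boost

/-! ### Caps as half-space sections of the sphere -/

section Caps

variable {E : Type*} [NormedAddCommGroup E] [InnerProductSpace ℝ E]

lemma norm_sub_inner_smul_sq {n y : E} (hn : ‖n‖ = 1) (hy : ‖y‖ = 1) :
    ‖y - ⟪n, y⟫ • n‖ ^ 2 = 1 - ⟪n, y⟫ ^ 2 := by
  rw [norm_sub_sq_real, norm_smul, inner_smul_right, real_inner_comm, mul_pow, hn, hy,
    Real.norm_eq_abs, sq_abs]
  ring

lemma inner_sub_inner_smul {n : E} (hn : ‖n‖ = 1) (y : E) : ⟪n, y - ⟪n, y⟫ • n⟫ = 0 := by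
  rw [inner_sub_right, inner_smul_right, real_inner_self_eq_norm_sq, hn]
  ring

lemma norm_smul_add_sqrt_smul {n u : E} (hn : ‖n‖ = 1) (hu : ‖u‖ = 1) (hnu : ⟪n, u⟫ = 0) {t : ℝ}
    (ht : t ^ 2 ≤ 1) : ‖t • n + √(1 - t ^ 2) • u‖ = 1 := by
  have h : ‖t • n + √(1 - t ^ 2) • u‖ ^ 2 = 1 := by
    rw [norm_add_sq_real, norm_smul, norm_smul, inner_smul_left, inner_smul_right, hnu, mul_pow,
      mul_pow, hn, hu, Real.norm_eq_abs, Real.norm_eq_abs, sq_abs, sq_abs,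
      Real.sq_sqrt (by linarith)]
    simp
  exact (pow_eq_one_iff_of_nonneg (norm_nonneg _) two_ne_zero).1 h

lemma inner_smul_add_smul {n u : E} (hn : ‖n‖ = 1) (hnu : ⟪n, u⟫ = 0) (t r : ℝ) :
    ⟪n, t • n + r • u⟫ = t := by
  rw [inner_add_right, inner_smul_right, inner_smul_right, hnu, real_inner_self_eq_norm_sq, hn]
  ring

lemma inner_mem_Icc {n y : E} (hn : ‖n‖ = 1) (hy : ‖y‖ = 1) : ⟪n, y⟫ ∈ Set.Icc (-1 : ℝ) 1 := by
  have := abs_real_inner_le_norm n y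
  rw [hn, hy, mul_one] at this
  exact abs_le.1 this

lemma eq_of_inner_sq_eq_one {n y : E} (hn : ‖n‖ = 1) (hy : ‖y‖ = 1) {c : ℝ}
    (hc : 1 ≤ c ^ 2) (h : ⟪n, y⟫ = c) : y = c • n := by
  have h1 := norm_sub_inner_smul_sq hn hy
  rw [h] at h1
  have h2 : ‖y - c • n‖ ^ 2 = 0 := le_antisymm (by linarith) (sq_nonneg _)
  exact sub_eq_zero.1 (norm_eq_zero.1 (pow_eq_zero_iff two_ne_zero |>.1 h2))

/-- Each point is joined to the pole `n` by the meridian arc, on which the inner product with `n`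
only increases. The bound on `c` excludes the antipode of `n`. -/
lemma isPreconnected_openCap {n : E} (hn : ‖n‖ = 1) {c : ℝ} (hc : -1 ≤ c) :
    IsPreconnected {y : Metric.sphere (0 : E) 1 | c < ⟪n, (y : E)⟫} := by
  refine isPreconnected_of_forall ⟨n, mem_sphere_zero_iff_norm.2 hn⟩ fun y (hy : c < _) => ?_
  have hy1 := norm_eq_of_mem_sphere y
  obtain ⟨-, ha1⟩ := inner_mem_Icc hn hy1
  by_cases hw : (y : E) - ⟪n, (y : E)⟫ • n = 0
  · have hsq := norm_sub_inner_smul_sq hn hy1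
    rw [hw, norm_zero] at hsq
    have h1 : ⟪n, (y : E)⟫ = 1 := by nlinarith
    have hyn : y = ⟨n, mem_sphere_zero_iff_norm.2 hn⟩ := by
      rw [h1, one_smul, sub_eq_zero] at hw
      exact Subtype.ext hw
    refine ⟨{y}, by simpa using hy, by simp [hyn], by simp, isPreconnected_singleton⟩
  · set a : ℝ := ⟪n, (y : E)⟫ with ha
    set w : E := (y : E) - a • n with hwdef
    have hnw : ⟪n, w⟫ = 0 := inner_sub_inner_smul hn _
    have hwsq : ‖w‖ ^ 2 = 1 - a ^ 2 := norm_sub_inner_smul_sq hn hy1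
    have hw0 : ‖w‖ ≠ 0 := norm_ne_zero_iff.2 hw
    have hu : ‖‖w‖⁻¹ • w‖ = 1 := by
      rw [norm_smul, norm_inv, norm_norm, inv_mul_cancel₀ hw0]
    have hnu : ⟪n, ‖w‖⁻¹ • w⟫ = 0 := by rw [inner_smul_right, hnw, mul_zero]
    have hsub : ∀ t : Set.Icc a 1, (t : ℝ) ^ 2 ≤ 1 := fun t => by
      nlinarith [t.2.1, t.2.2]
    let γ : Set.Icc a 1 → Metric.sphere (0 : E) 1 := fun t =>
      ⟨(t : ℝ) • n + √(1 - (t : ℝ) ^ 2) • ‖w‖⁻¹ • w,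
        mem_sphere_zero_iff_norm.2 (norm_smul_add_sqrt_smul hn hu hnu (hsub t))⟩
    have hγ : Continuous γ := by
      refine Continuous.subtype_mk ?_ _
      fun_prop
    have : PreconnectedSpace (Set.Icc a 1) :=
      Subtype.preconnectedSpace isPreconnected_Icc
    refine ⟨Set.range γ, ?_, ⟨⟨1, ha1, le_rfl⟩, ?_⟩, ⟨⟨a, le_rfl, ha1⟩, ?_⟩,
      isPreconnected_range hγ⟩
    · rintro _ ⟨t, rfl⟩
      change c < ⟪n, (t : ℝ) • n + √(1 - (t : ℝ) ^ 2) • ‖w‖⁻¹ • w⟫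
      rw [inner_smul_add_smul hn hnu]
      exact hy.trans_le t.2.1
    · exact Subtype.ext (by simp [γ])
    · refine Subtype.ext ?_
      change a • n + √(1 - a ^ 2) • ‖w‖⁻¹ • w = y
      rw [← hwsq, Real.sqrt_sq (norm_nonneg _), smul_smul, mul_inv_cancel₀ hw0, one_smul, hwdef]
      abel

lemma subset_interior_or_subset_compl {X : Type*} [TopologicalSpace X] {C U : Set X}
    (hC : IsClosed C) (hU : IsPreconnected U) (h : Disjoint U (frontier C)) :
    U ⊆ interior C ∨ U ⊆ Cᶜ := by
  refine hU.subset_or_subset isOpen_interior hC.isOpen_compl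
    (Set.disjoint_compl_right_iff_subset.2 interior_subset) fun y hy => ?_
  by_contra hcon
  rw [Set.mem_union, not_or, Set.mem_compl_iff, not_not] at hcon
  exact Set.disjoint_left.1 h hy ⟨subset_closure hcon.2, hcon.1⟩

end Caps

lemma IsCircularLine.exists_unit {k : Set S2} (hk : IsCircularLine k) :
    ∃ (n : EuclideanSpace ℝ (Fin 3)) (c : ℝ), ‖n‖ = 1 ∧ c ^ 2 < 1 ∧
      k = {y : S2 | ⟪n, (y : EuclideanSpace ℝ (Fin 3))⟫ = c} := by
  obtain ⟨⟨a, ha, b, hb, hab⟩, n, c, hn, rfl⟩ := hk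
  have hn0 : ‖n‖ ≠ 0 := norm_ne_zero_iff.2 hn
  have hiff : ∀ y : S2, ⟪‖n‖⁻¹ • n, (y : EuclideanSpace ℝ (Fin 3))⟫ = ‖n‖⁻¹ * c ↔
      ⟪n, (y : EuclideanSpace ℝ (Fin 3))⟫ = c := fun y => by
    rw [inner_smul_left, conj_trivial, mul_right_inj' (inv_ne_zero hn0)]
  have hn1 : ‖‖n‖⁻¹ • n‖ = 1 := by rw [norm_smul, norm_inv, norm_norm, inv_mul_cancel₀ hn0]
  refine ⟨‖n‖⁻¹ • n, ‖n‖⁻¹ * c, hn1, ?_, Set.ext fun y => (hiff y).symm⟩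
  -- A normalized plane at distance at least 1 from the origin meets the sphere at most in `c • n`,
  -- contradicting the two distinct points `a` and `b`.
  by_contra! hcon
  refine hab (Subtype.ext ?_)
  rw [eq_of_inner_sq_eq_one hn1 (norm_eq_of_mem_sphere a) hcon ((hiff a).2 ha),
    eq_of_inner_sq_eq_one hn1 (norm_eq_of_mem_sphere b) hcon ((hiff b).2 hb)]

/-- Both open sides of the boundary circle are connected and miss the frontier, so each lies in the
interior or in the complement of `C`. Both inside would make the frontier empty; both outside would
make the interior empty. -/
lemma IsSphericalCap.exists_eq {C : Set S2} (hC : IsSphericalCap C) :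
    ∃ (n : EuclideanSpace ℝ (Fin 3)) (c : ℝ), ‖n‖ = 1 ∧ c ^ 2 < 1 ∧
      C = {y : S2 | c ≤ ⟪n, (y : EuclideanSpace ℝ (Fin 3))⟫} ∧
      frontier C = {y : S2 | ⟪n, (y : EuclideanSpace ℝ (Fin 3))⟫ = c} := by
  obtain ⟨n, c, hn, hc, hF⟩ := hC.frontier_isCircularLine.exists_unit
  have hFC : frontier C ⊆ C := hC.isClosed.frontier_subset
  have hc' := abs_lt.1 ((sq_lt_one_iff_abs_lt_one c).1 hc)
  have key : ∀ (n : EuclideanSpace ℝ (Fin 3)) (c : ℝ),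
      frontier C = {y : S2 | ⟪n, (y : EuclideanSpace ℝ (Fin 3))⟫ = c} →
      {y : S2 | c < ⟪n, (y : EuclideanSpace ℝ (Fin 3))⟫} ⊆ interior C →
      {y : S2 | ⟪n, (y : EuclideanSpace ℝ (Fin 3))⟫ < c} ⊆ Cᶜ →
      C = {y : S2 | c ≤ ⟪n, (y : EuclideanSpace ℝ (Fin 3))⟫} := by
    intro n c hF hp hm
    ext y
    refine ⟨fun hy => show c ≤ _ from not_lt.1 fun h => hm h hy, fun hy => ?_⟩
    rcases (show c ≤ ⟪n, (y : EuclideanSpace ℝ (Fin 3))⟫ from hy).eq_or_lt with h | h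
    · exact hFC (hF ▸ h.symm)
    · exact interior_subset (hp h)
  have hneg : {y : S2 | ⟪n, (y : EuclideanSpace ℝ (Fin 3))⟫ < c} =
      {y : S2 | -c < ⟪-n, (y : EuclideanSpace ℝ (Fin 3))⟫} := by
    ext y; simp [inner_neg_left]
  have hneg' : {y : S2 | c < ⟪n, (y : EuclideanSpace ℝ (Fin 3))⟫} =
      {y : S2 | ⟪-n, (y : EuclideanSpace ℝ (Fin 3))⟫ < -c} := by
    ext y; simp [inner_neg_left]
  have hFneg : frontier C = {y : S2 | ⟪-n, (y : EuclideanSpace ℝ (Fin 3))⟫ = -c} := by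
    rw [hF]; ext y; simp [inner_neg_left]
  have hp := subset_interior_or_subset_compl hC.isClosed
    (isPreconnected_openCap hn hc'.1.le) (by
      rw [hF]; exact Set.disjoint_left.2 fun y (h : c < _) (h' : _ = c) => h.ne' h')
  have hm := subset_interior_or_subset_compl hC.isClosed
    (isPreconnected_openCap (n := -n) (by rwa [norm_neg]) (neg_le_neg hc'.2.le)) (by
      rw [hFneg]; exact Set.disjoint_left.2 fun y (h : -c < _) (h' : _ = -c) => h.ne' h')
  rcases hp with hp | hp <;> rcases hm with hm | hm
  · exfalso
    have huniv : C = Set.univ := Set.eq_univ_of_forall fun y => by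
      rcases lt_trichotomy ⟪n, (y : EuclideanSpace ℝ (Fin 3))⟫ c with h | h | h
      · exact interior_subset (hm (hneg ▸ h))
      · exact hFC (hF ▸ h)
      · exact interior_subset (hp h)
    obtain ⟨a, ha, -⟩ := hC.frontier_isCircularLine.1
    simp [huniv] at ha
  · exact ⟨n, c, hn, hc, key n c hF hp (hneg ▸ hm), hF⟩
  · exact ⟨-n, -c, by rwa [norm_neg], by rwa [neg_sq], key _ _ hFneg hm (hneg' ▸ hp), hFneg⟩
  · exfalso
    obtain ⟨y, hy⟩ := hC.interior_nonempty
    have hyC := interior_subset hy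
    rcases lt_trichotomy ⟪n, (y : EuclideanSpace ℝ (Fin 3))⟫ c with h | h | h
    · exact hm (hneg ▸ h) hyC
    · exact (hF ▸ h : y ∈ frontier C).2 hy
    · exact hp h hyC

/-- The center of the cap cut out by a half-space is its unit normal. -/
lemma isCapCenter_of_eq {C : Set S2} {n : S2} {c : ℝ} (hc : c ^ 2 < 1)
    (hC : C = {y : S2 | c ≤ ⟪(n : EuclideanSpace ℝ (Fin 3)), (y : EuclideanSpace ℝ (Fin 3))⟫})
    (hF : frontier C =
      {y : S2 | ⟪(n : EuclideanSpace ℝ (Fin 3)), (y : EuclideanSpace ℝ (Fin 3))⟫ = c}) :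
    IsCapCenter C n := by
  have hn := norm_eq_of_mem_sphere n
  have hc' := abs_lt.1 ((sq_lt_one_iff_abs_lt_one c).1 hc)
  have hdist : ∀ q x : S2, dist q x ^ 2 =
      2 - 2 * ⟪(q : EuclideanSpace ℝ (Fin 3)), (x : EuclideanSpace ℝ (Fin 3))⟫ := fun q x => by
    rw [Subtype.dist_eq, dist_eq_norm, norm_sub_sq_real, norm_eq_of_mem_sphere q,
      norm_eq_of_mem_sphere x]
    ring
  intro q
  constructor
  · rintro ⟨hqC, r, hr⟩
    have hq := norm_eq_of_mem_sphere q
    by_cases hw : (q : EuclideanSpace ℝ (Fin 3)) - ⟪(n : EuclideanSpace ℝ (Fin 3)),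
        (q : EuclideanSpace ℝ (Fin 3))⟫ • (n : EuclideanSpace ℝ (Fin 3)) = 0
    · have hsq := norm_sub_inner_smul_sq hn hq
      rw [hw, norm_zero] at hsq
      rw [hC] at hqC
      have hqC' : c ≤ ⟪(n : EuclideanSpace ℝ (Fin 3)), (q : EuclideanSpace ℝ (Fin 3))⟫ := hqC
      -- The antipode `-n` is equidistant from the circle too, but `-1 < c` keeps it out of the cap.
      have h1 : ⟪(n : EuclideanSpace ℝ (Fin 3)), (q : EuclideanSpace ℝ (Fin 3))⟫ = 1 := by
        nlinarith
      rw [h1, one_smul, sub_eq_zero] at hw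
      exact Subtype.ext hw
    · exfalso
      set w := (q : EuclideanSpace ℝ (Fin 3)) - ⟪(n : EuclideanSpace ℝ (Fin 3)),
        (q : EuclideanSpace ℝ (Fin 3))⟫ • (n : EuclideanSpace ℝ (Fin 3)) with hwdef
      have hnw : ⟪(n : EuclideanSpace ℝ (Fin 3)), w⟫ = 0 := inner_sub_inner_smul hn _
      have hw0 : ‖w‖ ≠ 0 := norm_ne_zero_iff.2 hw
      have hqw : ⟪(q : EuclideanSpace ℝ (Fin 3)), w⟫ = ‖w‖ ^ 2 := by
        rw [← real_inner_self_eq_norm_sq]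
        conv_rhs => rw [hwdef, inner_sub_left, ← hwdef, inner_smul_left, hnw]
        simp
      -- If `q` has a nonzero component `w` orthogonal to `n`, the circle points in the directions
      -- `w` and `-w` are at different distances from `q`.
      have hval : ∀ u : EuclideanSpace ℝ (Fin 3), ‖u‖ = 1 →
          ⟪(n : EuclideanSpace ℝ (Fin 3)), u⟫ = 0 →
          r ^ 2 = 2 - 2 * ⟪(q : EuclideanSpace ℝ (Fin 3)),
            c • (n : EuclideanSpace ℝ (Fin 3)) + √(1 - c ^ 2) • u⟫ := fun u hu hnu => by
        rw [← hr ⟨c • (n : EuclideanSpace ℝ (Fin 3)) + √(1 - c ^ 2) • u,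
          mem_sphere_zero_iff_norm.2 (norm_smul_add_sqrt_smul hn hu hnu hc.le)⟩
          (hF ▸ inner_smul_add_smul hn hnu _ _), hdist]
      have hu : ‖‖w‖⁻¹ • w‖ = 1 := by rw [norm_smul, norm_inv, norm_norm, inv_mul_cancel₀ hw0]
      have hnu : ⟪(n : EuclideanSpace ℝ (Fin 3)), ‖w‖⁻¹ • w⟫ = 0 := by
        rw [inner_smul_right, hnw, mul_zero]
      have h1 := hval _ hu hnu
      have h2 := hval (-(‖w‖⁻¹ • w)) (by rwa [norm_neg]) (by rw [inner_neg_right, hnu, neg_zero])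
      rw [smul_neg, inner_add_right, inner_neg_right] at h2
      rw [inner_add_right] at h1
      have h3 : ⟪(q : EuclideanSpace ℝ (Fin 3)), √(1 - c ^ 2) • ‖w‖⁻¹ • w⟫ = 0 := by linarith
      rw [inner_smul_right, inner_smul_right, hqw] at h3
      have hs : 0 < √(1 - c ^ 2) := Real.sqrt_pos.2 (by linarith)
      have hwpos : 0 < ‖w‖ := norm_pos_iff.2 hw
      have : 0 < √(1 - c ^ 2) * (‖w‖⁻¹ * ‖w‖ ^ 2) := by positivity
      linarith
  · rintro rfl
    refine ⟨?_, √(2 - 2 * c), fun x hx => ?_⟩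
    · rw [hC]
      change c ≤ _
      rw [real_inner_self_eq_norm_sq, hn]
      linarith
    · rw [hF] at hx
      rw [← Real.sqrt_sq dist_nonneg, hdist]
      congr 3

lemma isCapCenter_of_eq_of_sq_lt {C : Set S2} {n : EuclideanSpace ℝ (Fin 3)} {c : ℝ} {p : S2}
    (hc : c ^ 2 < ‖n‖ ^ 2) (hC : C = {y : S2 | c ≤ ⟪n, (y : EuclideanSpace ℝ (Fin 3))⟫})
    (hF : frontier C = {y : S2 | ⟪n, (y : EuclideanSpace ℝ (Fin 3))⟫ = c})
    (hp : (p : EuclideanSpace ℝ (Fin 3)) = ‖n‖⁻¹ • n) : IsCapCenter C p := by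
  have hn : 0 < ‖n‖ := by
    by_contra! h
    have : ‖n‖ = 0 := le_antisymm h (norm_nonneg _)
    rw [this] at hc
    nlinarith [sq_nonneg c]
  refine isCapCenter_of_eq (c := ‖n‖⁻¹ * c) ?_ ?_ ?_
  · rw [mul_pow, inv_pow, inv_mul_lt_one₀ (by positivity)]
    exact hc
  · rw [hC, hp]
    ext y
    simp only [Set.mem_ofPred_eq, inner_smul_left, conj_trivial]
    rw [mul_le_mul_iff_right₀ (inv_pos.2 hn)]
  · rw [hF, hp]
    ext y
    simp only [Set.mem_ofPred_eq, inner_smul_left, conj_trivial]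
    rw [mul_right_inj' (inv_pos.2 hn).ne']

/-! ### A point of the sphere lies in at most two caps of a packing -/

section AtMostTwo

variable {E : Type*} [NormedAddCommGroup E] [InnerProductSpace ℝ E]

/-- The function `⟪n, z⟫ - c * ‖z‖` is homogeneous in `z`, so its sign decides whether `z / ‖z‖` is
in the open cap. At `ξ` it is nonnegative, with derivative `⟪n - c • ξ, h⟫` along `h`. -/
lemma eventually_mul_norm_lt_inner {n ξ h : E} {c : ℝ} (hξ : ‖ξ‖ = 1) (hc : c ≤ ⟪n, ξ⟫)
    (hh : 0 < ⟪n - c • ξ, h⟫) :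
    ∀ᶠ ε : ℝ in 𝓝[>] 0, c * ‖ξ + ε • h‖ < ⟪n, ξ + ε • h⟫ := by
  have hcurve : HasDerivAt (fun ε : ℝ => ξ + ε • h) h 0 := by
    simpa using ((hasDerivAt_id (0 : ℝ)).smul_const h).const_add ξ
  have hnorm : HasDerivAt (fun ε : ℝ => ‖ξ + ε • h‖) ⟪ξ, h⟫ 0 := by
    have := hcurve.norm_sq.sqrt (by simp [hξ])
    simpa [Real.sqrt_sq, hξ] using this
  have hinner : HasDerivAt (fun ε : ℝ => ⟪n, ξ + ε • h⟫) ⟪n, h⟫ 0 := by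
    simpa using (hasDerivAt_const (0 : ℝ) n).inner ℝ hcurve
  have hg := (hinner.sub (hnorm.const_mul c)).tendsto_slope
  have hpos : 0 < ⟪n, h⟫ - c * ⟪ξ, h⟫ := by
    rwa [inner_sub_left, inner_smul_left, conj_trivial] at hh
  filter_upwards [(hg.mono_left (nhdsWithin_mono 0 fun _ (h : (0 : ℝ) < _) => h.ne')).eventually
    (lt_mem_nhds hpos), self_mem_nhdsWithin] with ε hε (hε0 : 0 < ε)
  rw [slope_def_field, sub_zero, div_pos_iff_of_pos_right hε0] at hε
  simp [hξ] at hε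
  linarith

/-- Two open caps whose closures share the point `ξ` meet unless they are externally tangent
at `ξ`. -/
lemma exists_mem_openCap_inter {n₁ n₂ ξ : E} {c₁ c₂ : ℝ} (hξ : ‖ξ‖ = 1)
    (h₁ : c₁ ≤ ⟪n₁, ξ⟫) (h₂ : c₂ ≤ ⟪n₂, ξ⟫) (hw₁ : n₁ - c₁ • ξ ≠ 0) (hw₂ : n₂ - c₂ • ξ ≠ 0)
    (hne : ‖n₁ - c₁ • ξ‖⁻¹ • (n₁ - c₁ • ξ) ≠ -(‖n₂ - c₂ • ξ‖⁻¹ • (n₂ - c₂ • ξ))) :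
    ∃ y : E, ‖y‖ = 1 ∧ c₁ < ⟪n₁, y⟫ ∧ c₂ < ⟪n₂, y⟫ := by
  set w₁ := n₁ - c₁ • ξ with hw₁'
  set w₂ := n₂ - c₂ • ξ with hw₂'
  have p₁ : 0 < ‖w₁‖ := norm_pos_iff.2 hw₁
  have p₂ : 0 < ‖w₂‖ := norm_pos_iff.2 hw₂
  set a := ‖w₁‖⁻¹ • w₁ with ha
  set b := ‖w₂‖⁻¹ • w₂ with hb
  have ha1 : ‖a‖ = 1 := by rw [ha, norm_smul, norm_inv, norm_norm, inv_mul_cancel₀ p₁.ne']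
  have hb1 : ‖b‖ = 1 := by rw [hb, norm_smul, norm_inv, norm_norm, inv_mul_cancel₀ p₂.ne']
  -- For unit vectors `a ≠ -b`, the bisecting direction `a + b` has positive inner product with
  -- both, so moving along it enters both open caps.
  have hab : 0 < 1 + ⟪a, b⟫ := by
    have h := norm_add_sq_real a b
    have : 0 < ‖a + b‖ := norm_pos_iff.2 fun h => hne (eq_neg_of_add_eq_zero_left h)
    have : 0 < ‖a + b‖ ^ 2 := by positivity
    rw [ha1, hb1] at h
    linarith
  have e₁ : w₁ = ‖w₁‖ • a := by rw [ha, smul_smul, mul_inv_cancel₀ p₁.ne', one_smul]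
  have e₂ : w₂ = ‖w₂‖ • b := by rw [hb, smul_smul, mul_inv_cancel₀ p₂.ne', one_smul]
  have q₁ : 0 < ⟪w₁, a + b⟫ := by
    rw [e₁, inner_smul_left, inner_add_right, real_inner_self_eq_norm_sq, ha1, conj_trivial,
      one_pow]
    positivity
  have q₂ : 0 < ⟪w₂, a + b⟫ := by
    rw [e₂, inner_smul_left, inner_add_right, real_inner_self_eq_norm_sq, hb1, conj_trivial,
      one_pow, real_inner_comm, add_comm]
    positivity
  have hcont : Tendsto (fun ε : ℝ => ξ + ε • (a + b)) (𝓝[>] 0) (𝓝 ξ) := by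
    have : Continuous fun ε : ℝ => ξ + ε • (a + b) := by fun_prop
    simpa using (this.tendsto 0).mono_left nhdsWithin_le_nhds
  have hξ0 : ξ ≠ 0 := fun h => by simp [h] at hξ
  obtain ⟨ε, r₁, r₂, r₃⟩ := ((eventually_mul_norm_lt_inner hξ h₁ q₁).and
    ((eventually_mul_norm_lt_inner hξ h₂ q₂).and (hcont.eventually_ne hξ0))).exists
  set z := ξ + ε • (a + b)
  have hz : 0 < ‖z‖ := norm_pos_iff.2 r₃
  refine ⟨‖z‖⁻¹ • z, by rw [norm_smul, norm_inv, norm_norm, inv_mul_cancel₀ hz.ne'], ?_, ?_⟩ <;>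
  · rw [inner_smul_right, lt_inv_mul_iff₀ hz, mul_comm]
    assumption

end AtMostTwo

section Packing

variable {V : Type*} {C : V → Set S2} {n : V → EuclideanSpace ℝ (Fin 3)} {c : V → ℝ}

lemma sub_smul_ne_zero_of_sq_lt_one {E : Type*} [NormedAddCommGroup E] [NormedSpace ℝ E]
    {n ξ : E} {c : ℝ} (hn : ‖n‖ = 1) (hξ : ‖ξ‖ = 1) (hc : c ^ 2 < 1) : n - c • ξ ≠ 0 := by
  intro h
  rw [sub_eq_zero] at h
  rw [h, norm_smul, hξ, mul_one, Real.norm_eq_abs] at hn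
  exact ((sq_lt_one_iff_abs_lt_one c).1 hc).ne hn

lemma IsUnivalentCirclePacking.tangent (hC : IsUnivalentCirclePacking C) (hn : ∀ v, ‖n v‖ = 1)
    (hc : ∀ v, c v ^ 2 < 1)
    (hCeq : ∀ v, C v = {y : S2 | c v ≤ ⟪n v, (y : EuclideanSpace ℝ (Fin 3))⟫})
    {u v : V} (huv : u ≠ v) {ξ : S2} (hu : ξ ∈ C u) (hv : ξ ∈ C v) :
    ‖n u - c u • (ξ : EuclideanSpace ℝ (Fin 3))‖⁻¹ •
        (n u - c u • (ξ : EuclideanSpace ℝ (Fin 3))) =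
      -(‖n v - c v • (ξ : EuclideanSpace ℝ (Fin 3))‖⁻¹ •
        (n v - c v • (ξ : EuclideanSpace ℝ (Fin 3)))) := by
  have hξ := norm_eq_of_mem_sphere ξ
  have hint : ∀ v (y : S2), c v < ⟪n v, (y : EuclideanSpace ℝ (Fin 3))⟫ → y ∈ interior (C v) := by
    intro v y hy
    refine mem_interior.2 ⟨{y : S2 | c v < ⟪n v, (y : EuclideanSpace ℝ (Fin 3))⟫}, ?_, ?_, hy⟩
    · rw [hCeq v]
      exact fun z (hz : c v < _) => show c v ≤ _ from hz.le
    · exact isOpen_lt (by fun_prop) (by fun_prop)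
  by_contra hne
  rw [hCeq] at hu hv
  obtain ⟨y, hy, hyu, hyv⟩ := exists_mem_openCap_inter hξ hu hv
    (sub_smul_ne_zero_of_sq_lt_one (hn u) hξ (hc u))
    (sub_smul_ne_zero_of_sq_lt_one (hn v) hξ (hc v)) hne
  exact Set.disjoint_left.1 (hC.disjoint_interior u v huv)
    (hint u ⟨y, mem_sphere_zero_iff_norm.2 hy⟩ hyu) (hint v ⟨y, mem_sphere_zero_iff_norm.2 hy⟩ hyv)

/-- Three unit vectors cannot be pairwise opposite. -/
lemma IsUnivalentCirclePacking.not_mem_three (hC : IsUnivalentCirclePacking C)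
    {u v w : V} (huv : u ≠ v) (huw : u ≠ w) (hvw : v ≠ w) {ξ : S2} (hu : ξ ∈ C u) (hv : ξ ∈ C v) :
    ξ ∉ C w := by
  intro hw
  choose n c hn hc hCeq _ using fun v => (hC.isSphericalCap v).exists_eq
  have h1 := hC.tangent hn hc hCeq huv hu hv
  have h2 := hC.tangent hn hc hCeq huw hu hw
  have h3 := hC.tangent hn hc hCeq hvw hv hw
  rw [h3, neg_neg] at h1
  rw [h1, eq_neg_iff_add_eq_zero, ← two_smul ℝ, smul_eq_zero, or_iff_right two_ne_zero,
    smul_eq_zero, inv_eq_zero, norm_eq_zero, or_self] at h2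
  exact sub_smul_ne_zero_of_sq_lt_one (hn w) (norm_eq_of_mem_sphere ξ) (hc w) h2

open Classical in
lemma IsUnivalentCirclePacking.sum_ite_neg [Fintype V] [Nonempty V]
    (hC : IsUnivalentCirclePacking C) {m : V → ℝ} (hm : ∀ v, 0 < m v)
    (hsingle : ∀ u, 2 * m u < ∑ w, m w)
    (hpair : ∀ u v, u ≠ v → (C u ∩ C v).Nonempty → 2 * (m u + m v) < ∑ w, m w) (ξ : S2) :
    ∑ v, m v * (if ξ ∈ C v then 1 else -1) < 0 := by
  have hsum : ∑ v, m v * (if ξ ∈ C v then 1 else -1) =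
      2 * ∑ v with ξ ∈ C v, m v - ∑ v, m v := by
    rw [Finset.sum_filter, Finset.mul_sum, ← Finset.sum_sub_distrib]
    refine Finset.sum_congr rfl fun v _ => ?_
    split_ifs <;> ring
  rw [hsum, sub_neg]
  have hcard : (Finset.univ.filter fun v => ξ ∈ C v).card ≤ 2 := by
    by_contra! h
    obtain ⟨u, hu, v, hv, w, hw, huv, huw, hvw⟩ := Finset.two_lt_card.1 h
    simp only [Finset.mem_filter, Finset.mem_univ, true_and] at hu hv hw
    exact hC.not_mem_three huv huw hvw hu hv hw
  rcases hcard.lt_or_eq with h | h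
  · rcases (Nat.le_of_lt_succ h).lt_or_eq with h | h
    · rw [Finset.card_eq_zero.1 (Nat.lt_one_iff.1 h), Finset.sum_empty, mul_zero]
      exact Finset.sum_pos (fun v _ => hm v) Finset.univ_nonempty
    · obtain ⟨u, hu⟩ := Finset.card_eq_one.1 h
      rw [hu, Finset.sum_singleton]
      exact hsingle u
  · obtain ⟨u, v, huv, hs⟩ := Finset.card_eq_two.1 h
    rw [hs, Finset.sum_pair huv]
    have hmem : ∀ w ∈ ({u, v} : Finset V), ξ ∈ C w := fun w hw => by
      rw [← hs] at hw
      exact (Finset.mem_filter.1 hw).2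
    exact hpair u v huv ⟨ξ, hmem u (by simp), hmem v (by simp)⟩

end Packing

/-! ### The signed distance to the hyperbolic plane spanned by a cap -/

section Potential

variable {E : Type*} [NormedAddCommGroup E] [InnerProductSpace ℝ E]

/-- The signed hyperbolic distance from the point of the hyperboloid over `x` to the plane bounded
by the circle `⟪n, y⟫ = c`. -/
noncomputable def planeDist (n : E) (c : ℝ) (x : E) : ℝ :=
  Real.arsinh ((⟪n, x⟫ - c * height x) / √(1 - c ^ 2))

lemma continuous_planeDist (n : E) (c : ℝ) : Continuous (planeDist n c) := by
  have := continuous_height (E := E)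
  unfold planeDist
  exact Real.continuous_arsinh.comp (by fun_prop)

lemma arsinh_le_log {t : ℝ} (ht : 1 ≤ t) : Real.arsinh t ≤ Real.log (3 * t) := by
  rw [Real.arsinh]
  refine Real.log_le_log (by positivity) ?_
  have : √(1 + t ^ 2) ≤ 2 * t := Real.sqrt_le_iff.2 ⟨by positivity, by nlinarith⟩
  linarith

lemma log_le_arsinh {t : ℝ} (ht : 0 < t) : Real.log t ≤ Real.arsinh t := by
  rw [Real.arsinh]
  exact Real.log_le_log ht (le_add_of_nonneg_right (Real.sqrt_nonneg _))

lemma planeDist_le {n : E} {c : ℝ} (hn : ‖n‖ = 1) (hc : c ^ 2 < 1) (x : E) :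
    planeDist n c x ≤ Real.log (height x) + Real.log (3 * (2 / √(1 - c ^ 2))) := by
  have hs : 0 < √(1 - c ^ 2) := Real.sqrt_pos.2 (by linarith)
  have hs1 : √(1 - c ^ 2) ≤ 1 := Real.sqrt_le_one.2 (by nlinarith [sq_nonneg c])
  have hx := height_pos x
  have hc' := abs_lt.1 ((sq_lt_one_iff_abs_lt_one c).1 hc)
  have h1 : ⟪n, x⟫ ≤ height x := by
    have := real_inner_le_norm n x
    rw [hn, one_mul] at this
    exact this.trans (norm_lt_height x).le
  have h2 : ⟪n, x⟫ - c * height x ≤ 2 * height x := by nlinarith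
  have h3 : 1 ≤ 2 / √(1 - c ^ 2) * height x := by
    have : 1 ≤ 2 / √(1 - c ^ 2) := (one_le_div hs).2 (by linarith)
    nlinarith [one_le_height x]
  calc planeDist n c x ≤ Real.arsinh (2 / √(1 - c ^ 2) * height x) := by
        refine Real.arsinh_le_arsinh.2 ?_
        rw [div_mul_eq_mul_div]
        gcongr
    _ ≤ Real.log (3 * (2 / √(1 - c ^ 2) * height x)) := arsinh_le_log h3
    _ = _ := by
        rw [← mul_assoc, Real.log_mul (by positivity) hx.ne', add_comm]

/-- Towards an ideal point outside a cap the signed distance to its plane decreases like minus the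
logarithm of the height. -/
lemma eventually_planeDist_le {n ξ : E} {c : ℝ} (hc : c ^ 2 < 1) (hξ : ⟪n, ξ⟫ < c)
    {l : Filter E} (hl : Tendsto (fun x => (height x)⁻¹ • x) l (𝓝 ξ)) :
    ∃ K : ℝ, ∀ᶠ x in l, planeDist n c x ≤ -Real.log (height x) + K := by
  have hs : 0 < √(1 - c ^ 2) := Real.sqrt_pos.2 (by linarith)
  set δ : ℝ := (c - ⟪n, ξ⟫) / 2 with hδ
  have hδ0 : 0 < δ := by rw [hδ]; linarith
  refine ⟨-Real.log (δ / √(1 - c ^ 2)), ?_⟩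
  have hlim : Tendsto (fun x => ⟪n, (height x)⁻¹ • x⟫) l (𝓝 ⟪n, ξ⟫) :=
    ((continuous_const.inner continuous_id).tendsto ξ).comp hl
  filter_upwards [hlim.eventually (gt_mem_nhds (show ⟪n, ξ⟫ < c - δ by linarith))] with x hx
  have hx0 := height_pos x
  rw [inner_smul_right, inv_mul_lt_iff₀ hx0] at hx
  have hpos : 0 < δ / √(1 - c ^ 2) := by positivity
  have hle : (⟪n, x⟫ - c * height x) / √(1 - c ^ 2) ≤ -(δ / √(1 - c ^ 2) * height x) := by
    rw [div_mul_eq_mul_div, ← neg_div]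
    gcongr
    nlinarith
  calc planeDist n c x ≤ Real.arsinh (-(δ / √(1 - c ^ 2) * height x)) :=
        Real.arsinh_le_arsinh.2 hle
    _ = -Real.arsinh (δ / √(1 - c ^ 2) * height x) := Real.arsinh_neg _
    _ ≤ -Real.log (δ / √(1 - c ^ 2) * height x) := neg_le_neg (log_le_arsinh (by positivity))
    _ = _ := by rw [Real.log_mul hpos.ne' hx0.ne']; ring

/-! ### The gradient of the signed distance -/

lemma hasFDerivAt_height (x : E) :
    HasFDerivAt (height : E → ℝ) ((height x)⁻¹ • innerSL ℝ x) x := by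
  have h := ((hasStrictFDerivAt_norm_sq x).hasFDerivAt.const_add 1).sqrt
    (by positivity : (1 + ‖x‖ ^ 2) ≠ 0)
  refine h.congr_fderiv ?_
  ext y
  simp [height]
  ring

/-- The right side is the denominator produced by differentiating `planeDist`, which is why the
gradient comes out divided by the norm of the boosted normal. -/
lemma norm_boostNormal {n : E} {c : ℝ} (hn : ‖n‖ = 1) (hc : c ^ 2 < 1) (x : E) :
    ‖boostNormal x n c‖ =
      √(1 - c ^ 2) * √(1 + ((⟪n, x⟫ - c * height x) / √(1 - c ^ 2)) ^ 2) := by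
  have hs : 0 < 1 - c ^ 2 := by linarith
  rw [← Real.sqrt_mul hs.le, ← Real.sqrt_sq (norm_nonneg (boostNormal x n c)),
    norm_boostNormal_sq, hn, div_pow, Real.sq_sqrt hs.le, boostLevel]
  congr 1
  field_simp
  ring

lemma hasFDerivAt_planeDist {n : E} {c : ℝ} (hn : ‖n‖ = 1) (hc : c ^ 2 < 1) (x : E) :
    HasFDerivAt (planeDist n c)
      (innerSL ℝ (‖boostNormal x n c‖⁻¹ • (n - (c * (height x)⁻¹) • x))) x := by
  have h := ((((innerSL ℝ n).hasFDerivAt (x := x)).sub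
    ((hasFDerivAt_height x).const_mul c)).mul_const (√(1 - c ^ 2))⁻¹).arsinh
  refine h.congr_fderiv ?_
  ext y
  rw [norm_boostNormal hn hc, mul_inv]
  simp [div_eq_mul_inv]
  ring

/-- The linear map turning the coordinate gradient of `planeDist` into the boosted normal. -/
noncomputable def boostFrame (x : E) : E →ₗ[ℝ] E :=
  LinearMap.id + ((innerₗ E x).smulRight ((1 + height x)⁻¹ • x))

lemma boostFrame_apply (x w : E) : boostFrame x w = w + (⟪x, w⟫ / (1 + height x)) • x := by
  simp [boostFrame, smul_smul, div_eq_mul_inv]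

/-- The map `boostFrame x` is linear and independent of the cap, so it can be applied to the whole
vanishing sum of gradients. -/
lemma boostFrame_gradient (x n : E) (c : ℝ) :
    boostFrame x (n - (c * (height x)⁻¹) • x) = boostNormal x n c := by
  have h0 := (height_pos x).ne'
  have h1 : (1 + height x) ≠ 0 := by linarith [height_pos x]
  have hX : ‖x‖ ^ 2 = height x ^ 2 - 1 := by rw [height_sq]; ring
  rw [boostFrame_apply, boostNormal, inner_sub_right, inner_smul_right, real_inner_self_eq_norm_sq,
    hX, real_inner_comm, sub_add_eq_add_sub, add_sub_assoc, add_sub_assoc, ← sub_smul, ← sub_smul]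
  congr 2
  field_simp
  ring

/-- Every ultrafilter going to infinity converges to an ideal point of the sphere. -/
lemma exists_tendsto_inv_height_smul [ProperSpace E] (l : Ultrafilter E)
    (hl : (l : Filter E) ≤ cocompact E) :
    ∃ ξ : E, ‖ξ‖ = 1 ∧ Tendsto (fun x => (height x)⁻¹ • x) l (𝓝 ξ) := by
  have hnorm : ∀ x : E, ‖(height x)⁻¹ • x‖ ^ 2 = 1 - (height x ^ 2)⁻¹ := fun x => by
    have h0 := (height_pos x).ne'
    have hX : ‖x‖ ^ 2 = height x ^ 2 - 1 := by rw [height_sq]; ring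
    rw [norm_smul, mul_pow, hX, Real.norm_eq_abs, sq_abs]
    field_simp
  obtain ⟨ξ, -, hξ⟩ := (isCompact_closedBall (0 : E) 1).ultrafilter_le_nhds'
    (l.map fun x => (height x)⁻¹ • x) (by
      refine Filter.mem_map.2 (Filter.univ_mem' fun x => ?_)
      have h := hnorm x
      have hx := height_pos x
      have : 0 < (height x ^ 2)⁻¹ := by positivity
      exact mem_closedBall_zero_iff.2 ((sq_le_one_iff₀ (norm_nonneg _)).1 (by linarith)))
  have hξ' : Tendsto (fun x => (height x)⁻¹ • x) l (𝓝 ξ) := hξ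
  refine ⟨ξ, ?_, hξ'⟩
  have h1 : Tendsto (fun x : E => 1 - (height x ^ 2)⁻¹) l (𝓝 (1 - 0)) :=
    tendsto_const_nhds.sub
      (((tendsto_pow_atTop two_ne_zero).comp (tendsto_height_atTop.mono_left hl)).inv_tendsto_atTop)
  have h2 := (hξ'.norm.pow 2).congr hnorm
  have h3 := tendsto_nhds_unique h2 h1
  rw [sub_zero] at h3
  exact (pow_eq_one_iff_of_nonneg (norm_nonneg _) two_ne_zero).1 h3

end Potential

open Classical in
/-- If every ideal point is outweighed by the caps not containing it, the weighted sum of signed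
distances tends to `-∞` at infinity. -/
lemma tendsto_sum_planeDist_atBot {V E : Type*} [Fintype V] [NormedAddCommGroup E]
    [InnerProductSpace ℝ E] [ProperSpace E] {m : V → ℝ} (hm : ∀ v, 0 < m v) {n : V → E} {c : V → ℝ}
    (hn : ∀ v, ‖n v‖ = 1) (hc : ∀ v, c v ^ 2 < 1)
    (hneg : ∀ ξ : E, ‖ξ‖ = 1 → ∑ v, m v * (if c v ≤ ⟪n v, ξ⟫ then 1 else -1) < 0) :
    Tendsto (fun x => ∑ v, m v * planeDist (n v) (c v) x) (cocompact E) atBot := by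
  -- Along an ultrafilter there is a single ideal limit point, so each summand gets one definite
  -- sign of logarithmic growth.
  refine (tendsto_iff_ultrafilter _ _ _).2 fun l hl => ?_
  obtain ⟨ξ, hξ, hlim⟩ := exists_tendsto_inv_height_smul l hl
  have hbound : ∀ v, ∃ K : ℝ, ∀ᶠ x in l, planeDist (n v) (c v) x ≤
      (if c v ≤ ⟪n v, ξ⟫ then 1 else -1) * Real.log (height x) + K := fun v => by
    split_ifs with h
    · exact ⟨_, Eventually.of_forall fun x => by
        rw [one_mul]; exact planeDist_le (hn v) (hc v) x⟩
    · obtain ⟨K, hK⟩ := eventually_planeDist_le (hc v) (not_le.1 h) hlim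
      exact ⟨K, by simpa using hK⟩
  choose K hK using hbound
  have hle : ∀ᶠ x in (l : Filter E), ∑ v, m v * planeDist (n v) (c v) x ≤
      (∑ v, m v * (if c v ≤ ⟪n v, ξ⟫ then 1 else -1)) * Real.log (height x) +
        ∑ v, m v * K v := by
    filter_upwards [eventually_all.2 hK] with x hx
    rw [Finset.sum_mul, ← Finset.sum_add_distrib]
    refine Finset.sum_le_sum fun v _ => ?_
    rw [mul_assoc, ← mul_add]
    exact mul_le_mul_of_nonneg_left (hx v) (hm v).le
  refine tendsto_atBot_mono' _ hle (tendsto_atBot_add_const_right _ _ ?_)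
  exact (Real.tendsto_log_atTop.comp (tendsto_height_atTop.mono_left hl)).const_mul_atTop_of_neg
    (hneg ξ hξ)

/-- A critical point of the weighted sum of signed distances, expressed by boosted normals. -/
lemma exists_sum_boostNormal_eq_zero {V E : Type*} [Fintype V] [NormedAddCommGroup E]
    [InnerProductSpace ℝ E] [ProperSpace E] {m : V → ℝ} {n : V → E} {c : V → ℝ}
    (hn : ∀ v, ‖n v‖ = 1) (hc : ∀ v, c v ^ 2 < 1)
    (hlim : Tendsto (fun x => ∑ v, m v * planeDist (n v) (c v) x) (cocompact E) atBot) :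
    ∃ x : E, ∑ v, m v • ‖boostNormal x (n v) (c v)‖⁻¹ • boostNormal x (n v) (c v) = 0 := by
  obtain ⟨x, hx⟩ := Continuous.exists_forall_ge (f := fun x => ∑ v, m v * planeDist (n v) (c v) x)
    (continuous_finsetSum _ fun v _ => (continuous_planeDist (n v) (c v)).const_mul (m v)) hlim
  have hder := HasFDerivAt.fun_sum (u := Finset.univ) fun v _ =>
    (hasFDerivAt_planeDist (hn v) (hc v) x).const_mul (m v)
  have hmax : IsLocalMax (fun x => ∑ v, m v * planeDist (n v) (c v) x) x :=
    Eventually.of_forall hx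
  have h0 := hmax.hasFDerivAt_eq_zero hder
  have hsum : ∑ v, m v • ‖boostNormal x (n v) (c v)‖⁻¹ •
      (n v - (c v * (height x)⁻¹) • x) = 0 := by
    refine ext_inner_right ℝ fun y => ?_
    have := congrArg (fun L : E →L[ℝ] ℝ => L y) h0
    simpa [sum_inner, inner_smul_left, inner_sub_left] using this
  refine ⟨x, ?_⟩
  have := congrArg (boostFrame x) hsum
  simpa only [map_sum, map_smul, boostFrame_gradient, map_zero] using this

/-! ### Boosts preserve caps -/

/-- Since `‖n‖ ^ 2 - c ^ 2` is invariant and positive, the boosted plane still cuts the sphere in a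
genuine circle. -/
lemma boostLevel_sq_lt {E : Type*} [NormedAddCommGroup E] [InnerProductSpace ℝ E] {n : E} {c : ℝ}
    (hn : ‖n‖ = 1) (hc : c ^ 2 < 1) (x : E) :
    boostLevel x n c ^ 2 < ‖boostNormal x n c‖ ^ 2 := by
  rw [norm_boostNormal_sq, hn]
  linarith

lemma boostNormal_ne_zero {E : Type*} [NormedAddCommGroup E] [InnerProductSpace ℝ E] {n : E} {c : ℝ}
    (hn : ‖n‖ = 1) (hc : c ^ 2 < 1) (x : E) : boostNormal x n c ≠ 0 := by
  intro h
  have := boostLevel_sq_lt hn hc x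
  rw [h, norm_zero] at this
  nlinarith [sq_nonneg (boostLevel x n c)]

lemma IsCircularLine.image_boostHomeo {k : Set S2} (hk : IsCircularLine k)
    (x : EuclideanSpace ℝ (Fin 3)) : IsCircularLine (boostHomeo x '' k) := by
  refine ⟨hk.1.image (boostHomeo x).injective, ?_⟩
  obtain ⟨n, c, hn, hc, rfl⟩ := hk.exists_unit
  exact ⟨_, _, boostNormal_ne_zero hn hc x, boostHomeo_image_setOf_eq x n c⟩

lemma IsSphericalCap.image_boostHomeo {D : Set S2} (hD : IsSphericalCap D)
    (x : EuclideanSpace ℝ (Fin 3)) : IsSphericalCap (boostHomeo x '' D) where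
  isClosed := (boostHomeo x).isClosed_image.2 hD.isClosed
  isConnected := hD.isConnected.image _ (boostHomeo x).continuous.continuousOn
  interior_nonempty := by
    rw [← (boostHomeo x).image_interior]
    exact hD.interior_nonempty.image _
  frontier_isCircularLine := by
    rw [← (boostHomeo x).image_frontier]
    exact hD.frontier_isCircularLine.image_boostHomeo x

lemma IsUnivalentCirclePacking.image_boostHomeo {V : Type*} {C : V → Set S2}
    (hC : IsUnivalentCirclePacking C) (x : EuclideanSpace ℝ (Fin 3)) :
    IsUnivalentCirclePacking fun v => boostHomeo x '' C v where
  isSphericalCap v := (hC.isSphericalCap v).image_boostHomeo x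
  disjoint_interior u v huv := by
    rw [← (boostHomeo x).image_interior, ← (boostHomeo x).image_interior]
    exact (Set.disjoint_image_iff (boostHomeo x).injective).2 (hC.disjoint_interior u v huv)

end CapPacking

/-! ### Normalizing the packing by a boost -/

theorem lemma3p1 {V : Type*} [Fintype V] (C : V → Set CapPacking.S2)
    (hC : CapPacking.IsUnivalentCirclePacking C)
    (m : V → ℝ) (hm : ∀ v, 0 < m v)
    (hsingle : ∀ u, 2 * m u < ∑ w, m w)
    (hpair : ∀ u v, u ≠ v → (C u ∩ C v).Nonempty → 2 * (m u + m v) < ∑ w, m w) :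
    ∃ f : CapPacking.S2 ≃ₜ CapPacking.S2,
      (∀ D : Set CapPacking.S2, CapPacking.IsSphericalCap D →
        CapPacking.IsSphericalCap (f '' D)) ∧
      CapPacking.IsUnivalentCirclePacking (fun v => f '' C v) ∧
      ∃ p : V → CapPacking.S2,
        (∀ v, CapPacking.IsCapCenter (f '' C v) (p v)) ∧
        ∑ v, m v • (p v : EuclideanSpace ℝ (Fin 3)) = 0 := by
  classical
  choose n c hn hc hCeq hF using fun v => (hC.isSphericalCap v).exists_eq
  obtain ⟨x, hx⟩ : ∃ x : EuclideanSpace ℝ (Fin 3),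
      ∑ v, m v • ‖CapPacking.boostNormal x (n v) (c v)‖⁻¹ •
        CapPacking.boostNormal x (n v) (c v) = 0 := by
    -- For empty `V` the potential is constantly zero and does not tend to `-∞`, but any `x` works.
    cases isEmpty_or_nonempty V
    · exact ⟨0, by simp⟩
    refine CapPacking.exists_sum_boostNormal_eq_zero hn hc
      (CapPacking.tendsto_sum_planeDist_atBot hm hn hc fun ξ hξ => ?_)
    have h := hC.sum_ite_neg hm hsingle hpair ⟨ξ, mem_sphere_zero_iff_norm.2 hξ⟩
    convert h using 5 with v
    rw [hCeq v]
    rfl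
  refine ⟨CapPacking.boostHomeo x, fun D hD => hD.image_boostHomeo x, hC.image_boostHomeo x,
    fun v => ⟨‖CapPacking.boostNormal x (n v) (c v)‖⁻¹ • CapPacking.boostNormal x (n v) (c v), ?_⟩,
    fun v => ?_, hx⟩
  · rw [mem_sphere_zero_iff_norm, norm_smul, norm_inv, norm_norm, inv_mul_cancel₀
      (norm_ne_zero_iff.2 (CapPacking.boostNormal_ne_zero (hn v) (hc v) x))]
  · refine CapPacking.isCapCenter_of_eq_of_sq_lt (CapPacking.boostLevel_sq_lt (hn v) (hc v) x)
      ?_ ?_ rfl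
    · rw [← CapPacking.boostHomeo_image_setOf_le, ← hCeq v]
    · rw [← (CapPacking.boostHomeo x).image_frontier, hF v, CapPacking.boostHomeo_image_setOf_eq]
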